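/- For $k\ge 4$, a $C(k)$ is a family of $k$ distinct sets in the plane with an ordering $F_1,\dots,F_k$ such that, with indices taken modulo $k$, $\operatorname{conv}(F_i\cup F_{i+1})\cap\operatorname{conv}(F_j\cup F_{j+1})=\emptyset$ whenever $\{i,i+1\}\cap\{j,j+1\}=\emptyset$. A family $\mathcal F$ of sets in the plane is $C(k)$-free if it contains no $C(k)$ as a subfamily, and it is pierced by $n$ lines if there are $n$ lines in the plane whose union intersects every set in $\mathcal F$. Theorem. Let $k\ge 4$. There is a least integer $L(k)\ge 0$ such that every $C(k)$-free family (finite or infinite) of nonempty compact convex sets in the plane can be pierced by $L(k)$ lines, and $$\left\lceil \tfrac{k}{2}\right\rceil\le L(k)\le k-2 .$$ -/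

import Mathlib

/-- The Euclidean plane. -/
abbrev Plane : Type := EuclideanSpace ℝ (Fin 2)

/-- A line in the plane: a one-dimensional affine subspace. -/
def IsLine (l : AffineSubspace ℝ Plane) : Prop :=
  Module.finrank ℝ l.direction = 1

/-- The family `𝓕` is pierced by `n` lines: there are `n` lines whose union meets every member
of `𝓕`. -/
def PiercedBy (n : ℕ) (𝓕 : Set (Set Plane)) : Prop :=
  ∃ l : Fin n → AffineSubspace ℝ Plane, (∀ i, IsLine (l i)) ∧
    ∀ A ∈ 𝓕, (A ∩ ⋃ i, (l i : Set Plane)).Nonempty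

/-- The `k` sets `F i`, indexed cyclically by the integers modulo `k`, form a `C(k)` (for `k ≥ 4`):
they are distinct, and `conv (F i ∪ F (i + 1))` and `conv (F j ∪ F (j + 1))` are disjoint whenever
`{i, i + 1}` and `{j, j + 1}` are. -/
def IsCycleFamily (k : ℕ) (F : ZMod k → Set Plane) : Prop :=
  Function.Injective F ∧
    ∀ i j : ZMod k, ({i, i + 1} : Set (ZMod k)) ∩ {j, j + 1} = ∅ →
      convexHull ℝ (F i ∪ F (i + 1)) ∩ convexHull ℝ (F j ∪ F (j + 1)) = ∅

/-- The family `𝓕` is `C(k)`-free: no `k` members of `𝓕`, in any order, form a `C(k)`. -/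
def IsCycleFree (k : ℕ) (𝓕 : Set (Set Plane)) : Prop :=
  ¬ ∃ F : ZMod k → Set Plane, (∀ i, F i ∈ 𝓕) ∧ IsCycleFamily k F

/-- The numbers `n` of lines that suffice to pierce every `C(k)`-free family (finite or infinite) of
nonempty compact convex sets in the plane. -/
def sufficientLineNumbers (k : ℕ) : Set ℕ :=
  {n | ∀ 𝓕 : Set (Set Plane),
    (∀ A ∈ 𝓕, A.Nonempty ∧ IsCompact A ∧ Convex ℝ A) → IsCycleFree k 𝓕 → PiercedBy n 𝓕}

/-- `L(k)`: the least number of lines that suffices to pierce every `C(k)`-free family of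
nonempty compact convex sets in the plane. -/
noncomputable def leastLineNumber (k : ℕ) : ℕ :=
  sInf (sufficientLineNumbers k)

/-!
The lower bound comes from the sides of a convex polygon with `2 k - 1` vertices on the parabola
`y = x ^ 2`. Members of a `C(k)` are pairwise disjoint
(`IsCycleFamily.pairwise_inter_eq_empty`), while among `k` of the `2 k - 1` sides two are adjacent,
so the sides are `C(k)`-free. A line meets the parabola at most twice and hence meets at most four
sides (`card_polygonSide_meeting_line_le`); so `n` piercing lines satisfy `2 k - 1 ≤ 4 n`, that is,
`k ≤ 2 n`.

For the upper bound, compactness of the space of unit coefficient vectors reduces the problem to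
finite families and to lines that come within `ε` of every set. Write `k = n + 4` and let `ℓ` be a
line of slope `s`. The height of `ℓ` is balanced on the left if, scanning from the left, sets
above `ℓ` and sets below `ℓ` first appear at the same moment `v`: by then there are sets on both
sides, while all sets ending before `v` are met by `ℓ`. For every slope there is such a height
(unless one line meets all sets), a continuous function of the slope (`balancedHeight`), and
likewise a height that is balanced on the right, with a moment `w`. A steep line is balanced on
the left near the right end of the set ending first, and on the right near the left end of the set
starting last. The vertical order in which `y = s x + t` passes these two places depends on the
sign of `s`, so by the intermediate value theorem some `ℓ` is balanced on both sides. If `w ≤ v`,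
then `ℓ` and the vertical line at `v` pierce everything. Otherwise the remaining sets lie strictly
between `v` and `w`, and greedily (`exists_chain_or_piercing`) either fewer than `n` vertical
lines pierce them, at most `n + 2` together with `ℓ` and the vertical lines at `v` and `w`, or `n`
of them are separated from each other by vertical lines. In the latter case these `n` sets and the
four sets that define `v` and `w`, ordered from left to right above `ℓ` and then from right to
left below `ℓ`, form a `C(n + 4)` (`isCycleFamily_of_keys`). The margin `ε` makes weak separation
from `ℓ` strict.
-/

/-! ### Sides of a convex polygon -/

/-- The point of abscissa `x` on the parabola `y = x ^ 2`. -/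
noncomputable def parabolaPoint (x : ℝ) : Plane := !₂[x, x ^ 2]

/-- The sides of the convex polygon with vertices `(j, j ^ 2)`, `0 ≤ j ≤ M`. Addition in
`Fin (M + 1)` is cyclic, so side `M` joins the last vertex to the first. -/
noncomputable def polygonSide (M : ℕ) (j : Fin (M + 1)) : Set Plane :=
  segment ℝ (parabolaPoint (j : ℕ)) (parabolaPoint ((j + 1 : Fin (M + 1)) : ℕ))

theorem exists_equation_of_isLine {l : AffineSubspace ℝ Plane} (hl : IsLine l) :
    ∃ a b c : ℝ, (a ≠ 0 ∨ b ≠ 0) ∧ ∀ p ∈ l, a * p 0 + b * p 1 + c = 0 := by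
  obtain ⟨⟨d, hd⟩, hd0, hspan⟩ := finrank_eq_one_iff'.1 hl
  rcases (l : Set Plane).eq_empty_or_nonempty with he | ⟨q, hq⟩
  · exact ⟨1, 0, 0, by simp, fun p hp => by
      have : p ∈ (l : Set Plane) := hp
      simp [he] at this⟩
  refine ⟨-d 1, d 0, d 1 * q 0 - d 0 * q 1, ?_, fun p hp => ?_⟩
  · by_contra! h
    apply hd0
    ext i
    fin_cases i
    · simpa using h.2
    · simpa using h.1
  · obtain ⟨μ, hμ⟩ := hspan ⟨p -ᵥ q, AffineSubspace.vsub_mem_direction hp hq⟩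
    have h : μ • d = p - q := by simpa using congrArg Subtype.val hμ
    have h0 : μ * d 0 = p 0 - q 0 := by simpa using congrArg (fun z : Plane => z 0) h
    have h1 : μ * d 1 = p 1 - q 1 := by simpa using congrArg (fun z : Plane => z 1) h
    linear_combination d 1 * h0 - d 0 * h1

theorem mul_nonpos_of_mem_segment {a b c x y : ℝ} {p : Plane}
    (hp : p ∈ segment ℝ (parabolaPoint x) (parabolaPoint y)) (h : a * p 0 + b * p 1 + c = 0) :
    (a * x + b * x ^ 2 + c) * (a * y + b * y ^ 2 + c) ≤ 0 := by
  obtain ⟨u, w, hu, hw, huw, rfl⟩ := hp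
  simp only [parabolaPoint, PiLp.add_apply, PiLp.smul_apply, smul_eq_mul, Matrix.cons_val_zero,
    Matrix.cons_val_one] at h
  set X := a * x + b * x ^ 2 + c with hX
  set Y := a * y + b * y ^ 2 + c with hY
  have h' : u * X + w * Y = 0 := by
    rw [hX, hY]; linear_combination h + c * huw
  rcases hu.eq_or_lt with rfl | hu
  · have : Y = 0 := by
      have : w = 1 := by linarith
      simpa [this] using h'
    simp [this]
  · have h1 : u * (X * Y) = -(w * Y ^ 2) := by linear_combination Y * h'
    have h2 : 0 ≤ w * Y ^ 2 := by positivity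
    by_contra! hc
    linarith [mul_pos hu hc]

theorem exists_root_of_mul_nonpos {a b c x y : ℝ} (hxy : x ≤ y)
    (h : (a * x + b * x ^ 2 + c) * (a * y + b * y ^ 2 + c) ≤ 0) :
    ∃ r, x ≤ r ∧ r ≤ y ∧ a * r + b * r ^ 2 + c = 0 := by
  have hc : ContinuousOn (fun r : ℝ => a * r + b * r ^ 2 + c) (Set.uIcc x y) := by fun_prop
  have h0 : (0 : ℝ) ∈ Set.uIcc (a * x + b * x ^ 2 + c) (a * y + b * y ^ 2 + c) := by
    rw [Set.mem_uIcc]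
    rcases mul_nonpos_iff.1 h with h | h
    · exact Or.inr ⟨h.2, h.1⟩
    · exact Or.inl h
  obtain ⟨r, hr, hr0⟩ := intermediate_value_uIcc hc h0
  rw [Set.uIcc_of_le hxy] at hr
  exact ⟨r, hr.1, hr.2, hr0⟩

/-- Vieta's formulas for a nonzero polynomial `a x + b x ^ 2 + c` with two distinct roots. -/
theorem vieta_of_two_roots {a b c r s : ℝ} (hab : a ≠ 0 ∨ b ≠ 0) (hrs : r < s)
    (hr : a * r + b * r ^ 2 + c = 0) (hs : a * s + b * s ^ 2 + c = 0) :
    b ≠ 0 ∧ a = -b * (r + s) ∧ c = b * r * s := by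
  have h : a = -b * (r + s) := by
    have h0 : (s - r) * (a + b * (r + s)) = 0 := by linear_combination hs - hr
    rcases mul_eq_zero.1 h0 with h0 | h0
    · linarith
    · linarith
  refine ⟨?_, h, ?_⟩
  · rintro rfl
    simp at h hab
    exact hab h
  · rw [h] at hr; linear_combination hr

theorem not_three_roots {a b c r s t : ℝ} (hab : a ≠ 0 ∨ b ≠ 0) (hrs : r < s) (hst : s < t)
    (hr : a * r + b * r ^ 2 + c = 0) (hs : a * s + b * s ^ 2 + c = 0)
    (ht : a * t + b * t ^ 2 + c = 0) : False := by
  obtain ⟨hb, h1, -⟩ := vieta_of_two_roots hab hrs hr hs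
  obtain ⟨-, h2, -⟩ := vieta_of_two_roots hab hst hs ht
  have : b * (t - r) = 0 := by linarith
  rcases mul_eq_zero.1 this with h | h
  · exact hb h
  · linarith

open Classical in
/-- The line meets the parabola at most twice, and each of these points lies over at most two
consecutive sides. -/
theorem card_polygonSide_meeting_line_le (M : ℕ) {a b c : ℝ} (hab : a ≠ 0 ∨ b ≠ 0) :
    (Finset.univ.filter fun j : Fin (M + 1) =>
      ∃ p ∈ polygonSide M j, a * p 0 + b * p 1 + c = 0).card ≤ 4 := by
  by_contra! hcard
  set S := Finset.univ.filter fun j : Fin (M + 1) =>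
      ∃ p ∈ polygonSide M j, a * p 0 + b * p 1 + c = 0 with hS
  let e := S.orderEmbOfCardLe (k := 5) hcard
  have hlt : ∀ m n : Fin 5, m < n → (e m : ℕ) + 1 ≤ (e n : ℕ) := fun m n h =>
    Fin.lt_def.1 (e.strictMono h)
  have hsign : ∀ m, (a * (e m : ℕ) + b * (e m : ℕ) ^ 2 + c) *
      (a * ((e m + 1 : Fin (M + 1)) : ℕ) + b * ((e m + 1 : Fin (M + 1)) : ℕ) ^ 2 + c) ≤ 0 := by
    intro m
    have : e m ∈ S := Finset.orderEmbOfCardLe_mem S hcard m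
    obtain ⟨p, hp, h⟩ := (Finset.mem_filter.1 this).2
    exact mul_nonpos_of_mem_segment hp h
  have hroot : ∀ m, (e m : ℕ) < M → ∃ r : ℝ, ((e m : ℕ) : ℝ) ≤ r ∧ r ≤ (e m : ℕ) + 1 ∧
      a * r + b * r ^ 2 + c = 0 := by
    intro m hm
    have h := hsign m
    rw [Fin.val_add_one_of_lt (Fin.lt_def.2 (by simpa using hm))] at h
    push_cast at h
    exact exists_root_of_mul_nonpos (by linarith) h
  have h01 := hlt 0 1 (by decide)
  have h12 := hlt 1 2 (by decide)
  have h23 := hlt 2 3 (by decide)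
  have h34 := hlt 3 4 (by decide)
  have h4M : (e 4 : ℕ) ≤ M := Nat.le_of_lt_succ (e 4).2
  obtain ⟨r0, hr0, hr0', hz0⟩ := hroot 0 (by omega)
  obtain ⟨r1, hr1, hr1', hz1⟩ := hroot 1 (by omega)
  obtain ⟨r2, hr2, hr2', hz2⟩ := hroot 2 (by omega)
  obtain ⟨r3, hr3, hr3', hz3⟩ := hroot 3 (by omega)
  have h01' : ((e 0 : ℕ) : ℝ) + 1 ≤ (e 1 : ℕ) := by exact_mod_cast h01
  have h12' : ((e 1 : ℕ) : ℝ) + 1 ≤ (e 2 : ℕ) := by exact_mod_cast h12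
  have h23' : ((e 2 : ℕ) : ℝ) + 1 ≤ (e 3 : ℕ) := by exact_mod_cast h23
  have h34' : ((e 3 : ℕ) : ℝ) + 1 ≤ (e 4 : ℕ) := by exact_mod_cast h34
  rcases h4M.lt_or_eq with h4 | h4
  · obtain ⟨r4, hr4, hr4', hz4⟩ := hroot 4 h4
    exact not_three_roots hab (r := r0) (s := r2) (t := r4) (by linarith) (by linarith) hz0 hz2 hz4
  · -- The closing side is met, while both roots lie strictly between its end points.
    have hr01 : r0 = r1 := by
      by_contra hne
      exact not_three_roots hab (lt_of_le_of_ne (by linarith) hne) (t := r3) (by linarith)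
        hz0 hz1 hz3
    have hr23 : r2 = r3 := by
      by_contra hne
      exact not_three_roots hab (r := r0) (by linarith) (lt_of_le_of_ne (by linarith) hne)
        hz0 hz2 hz3
    obtain ⟨hb, ha, hc⟩ := vieta_of_two_roots hab (r := r0) (s := r2) (by linarith) hz0 hz2
    have h := hsign 4
    rw [show e 4 = Fin.last M from Fin.ext (by simpa using h4), Fin.last_add_one] at h
    simp only [Fin.val_last, Fin.val_zero, Nat.cast_zero] at h
    rw [h4] at h34'
    have hpos : (0 : ℝ) ≤ (e 0 : ℕ) := Nat.cast_nonneg _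
    have h1 : 0 < r0 := by linarith
    have h2 : 0 < r2 := by linarith
    have h3 : 0 < (M : ℝ) - r0 := by linarith
    have h5 : 0 < (M : ℝ) - r2 := by linarith
    have : 0 < b ^ 2 * (r0 * r2 * ((M - r0) * (M - r2))) := by positivity
    rw [ha, hc] at h
    nlinarith

theorem IsCycleFamily.pairwise_inter_eq_empty {k : ℕ} (hk : 4 ≤ k) {F : ZMod k → Set Plane}
    (hF : IsCycleFamily k F) {x y : ZMod k} (hxy : x ≠ y) : F x ∩ F y = ∅ := by
  have key : ∀ (m : ℕ), 0 < m → m < 4 → ((m : ℕ) : ZMod k) ≠ 0 := fun m h0 h4 h => by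
    have := Nat.le_of_dvd h0 ((ZMod.natCast_eq_zero_iff m k).1 h)
    omega
  have h1 : (1 : ZMod k) ≠ 0 := by simpa using key 1 (by norm_num) (by norm_num)
  have h2 : (2 : ZMod k) ≠ 0 := by simpa using key 2 (by norm_num) (by norm_num)
  have h3 : (3 : ZMod k) ≠ 0 := by simpa using key 3 (by norm_num) (by norm_num)
  have hadj : ∀ x : ZMod k, F x ∩ F (x + 1) = ∅ := by
    intro x
    have h := hF.2 (x - 1) (x + 1) (by
      ext z
      simp only [Set.mem_inter_iff, Set.mem_insert_iff, Set.mem_singleton_iff,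
        Set.mem_empty_iff_false, iff_false]
      rintro ⟨rfl | rfl, h | h⟩
      · exact h2 (by linear_combination -h)
      · exact h3 (by linear_combination -h)
      · exact h1 (by linear_combination -h)
      · exact h2 (by linear_combination -h))
    rw [← Set.subset_empty_iff, ← h]
    refine Set.inter_subset_inter ?_ ?_
    · rw [sub_add_cancel]
      exact Set.subset_union_right.trans (subset_convexHull ℝ _)
    · exact Set.subset_union_left.trans (subset_convexHull ℝ _)
  by_cases hy : y = x + 1
  · rw [hy]; exact hadj x
  by_cases hx : x = y + 1
  · rw [hx, Set.inter_comm]; exact hadj y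
  have h := hF.2 x y (by
    ext z
    simp only [Set.mem_inter_iff, Set.mem_insert_iff, Set.mem_singleton_iff,
      Set.mem_empty_iff_false, iff_false]
    rintro ⟨rfl | rfl, h | h⟩
    · exact hxy h
    · exact hx h
    · exact hy h.symm
    · exact hxy (add_right_cancel h))
  rw [← Set.subset_empty_iff, ← h]
  exact Set.inter_subset_inter (Set.subset_union_left.trans (subset_convexHull ℝ _))
    (Set.subset_union_left.trans (subset_convexHull ℝ _))

/-- Among any `k` sides of a `(2 k - 1)`-gon, two are adjacent. -/
theorem isCycleFree_range_polygonSide {k : ℕ} (hk : 4 ≤ k) :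
    IsCycleFree k (Set.range (polygonSide (2 * k - 2))) := by
  rintro ⟨F, hmem, hF⟩
  have : NeZero k := ⟨by omega⟩
  choose σ hσ using hmem
  have hinj : Function.Injective σ := fun x y h => hF.1 (by rw [← hσ, ← hσ, h])
  let S := Finset.univ.image σ
  have hS : S.card = k := by
    rw [Finset.card_image_of_injective _ hinj, Finset.card_univ, ZMod.card]
  have hS' : (S.image (· + 1)).card = k := by
    rw [Finset.card_image_of_injective _ (add_left_injective 1), hS]
  have hnd : ¬ Disjoint S (S.image (· + 1)) := fun hd => by
    have h := Finset.card_le_univ (S ∪ S.image (· + 1))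
    rw [Finset.card_union_of_disjoint hd, hS, hS', Fintype.card_fin] at h
    omega
  obtain ⟨j, hj, hj'⟩ := Finset.not_disjoint_iff.1 hnd
  obtain ⟨i, hi, rfl⟩ := Finset.mem_image.1 hj'
  obtain ⟨x, -, rfl⟩ := Finset.mem_image.1 hi
  obtain ⟨y, -, hy⟩ := Finset.mem_image.1 hj
  have hxy : x ≠ y := by
    rintro rfl
    have h1 : (1 : Fin (2 * k - 2 + 1)) = 0 := by simpa using hy
    have := congrArg Fin.val h1
    rw [Fin.val_one', Fin.val_zero, Nat.mod_eq_of_lt (by omega)] at this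
    omega
  have h := hF.pairwise_inter_eq_empty hk hxy
  rw [← hσ, ← hσ, hy] at h
  have : parabolaPoint ((σ x + 1 : Fin (2 * k - 2 + 1)) : ℕ) ∈
      polygonSide (2 * k - 2) (σ x) ∩ polygonSide (2 * k - 2) (σ x + 1) :=
    ⟨right_mem_segment _ _ _, left_mem_segment _ _ _⟩
  rw [h] at this
  exact this

theorem two_mul_sub_one_le_of_mem_sufficientLineNumbers {k n : ℕ} (hk : 4 ≤ k)
    (hn : n ∈ sufficientLineNumbers k) : 2 * k - 1 ≤ 4 * n := by
  classical
  obtain ⟨l, hl, hmeet⟩ := hn (Set.range (polygonSide (2 * k - 2))) (by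
    rintro _ ⟨j, rfl⟩
    refine ⟨⟨_, left_mem_segment _ _ _⟩, ?_, convex_segment _ _⟩
    rw [polygonSide, ← convexHull_pair (𝕜 := ℝ)]
    exact (Set.toFinite _).isCompact_convexHull ℝ) (isCycleFree_range_polygonSide hk)
  choose a b c hab hline using fun i => exists_equation_of_isLine (hl i)
  have hcover : (Finset.univ : Finset (Fin (2 * k - 2 + 1))) ⊆
      (Finset.univ : Finset (Fin n)).biUnion fun i => Finset.univ.filter fun j =>
        ∃ p ∈ polygonSide (2 * k - 2) j, a i * p 0 + b i * p 1 + c i = 0 := by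
    intro j _
    obtain ⟨p, hp, hp'⟩ := hmeet _ ⟨j, rfl⟩
    obtain ⟨i, hi⟩ := Set.mem_iUnion.1 hp'
    simp only [Finset.mem_biUnion, Finset.mem_filter, Finset.mem_univ, true_and]
    exact ⟨i, p, hp, hline i p hi⟩
  have h := (Finset.card_le_card hcover).trans (Finset.card_biUnion_le_card_mul _ _ 4
    fun i _ => card_polygonSide_meeting_line_le _ (hab i))
  simp only [Finset.card_univ, Fintype.card_fin] at h
  omega

/-! ### The cyclic order around a transversal line -/

theorem convexHull_inter_eq_empty_of_lt (φ : Plane →ₗ[ℝ] ℝ) {A B : Set Plane}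
    (h : ∀ a ∈ A, ∀ b ∈ B, φ a < φ b) : convexHull ℝ A ∩ convexHull ℝ B = ∅ := by
  have h1 : ∀ a ∈ convexHull ℝ A, ∀ b ∈ B, φ a < φ b := fun a ha b hb =>
    convexHull_min (fun a' ha' => h a' ha' b hb)
      (convex_halfSpace_lt φ.isLinear (φ b)) ha
  have h2 : ∀ a ∈ convexHull ℝ A, ∀ b ∈ convexHull ℝ B, φ a < φ b := fun a ha b hb =>
    convexHull_min (fun b' hb' => h1 a ha b' hb')
      (convex_halfSpace_gt φ.isLinear (φ a)) hb
  ext p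
  simp only [Set.mem_inter_iff, Set.mem_empty_iff_false, iff_false]
  exact fun hp => lt_irrefl _ (h2 p hp.1 p hp.2)

/-- The cyclic order of the sets on both sides of a transversal line. The strips between vertical
lines are numbered `0, …, n + 1` from left to right; a set above the line `ψ = t` in strip `c` has
key `c`, one below it has key `2 n + 3 - c`, so `min K (2 n + 3 - K)` is the strip of key `K`.
If the first and the last strip contain a set on each side, then the increasing order of the keys
runs around the line, and it makes the sets a `C(n + 4)`. -/
theorem isCycleFamily_of_keys {n : ℕ} {S : Finset ℕ} (hcard : S.card = n + 4)
    (h0 : 0 ∈ S) (h1 : n + 1 ∈ S) (h2 : n + 2 ∈ S) (h3 : 2 * n + 3 ∈ S)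
    (hle : ∀ K ∈ S, K ≤ 2 * n + 3) (φ ψ : Plane →ₗ[ℝ] ℝ) (t : ℝ) (G : ℕ → Set Plane)
    (hne : ∀ K ∈ S, (G K).Nonempty)
    (hup : ∀ K ∈ S, K ≤ n + 1 → ∀ p ∈ G K, t < ψ p)
    (hdown : ∀ K ∈ S, n + 2 ≤ K → ∀ p ∈ G K, ψ p < t)
    (hsep : ∀ K ∈ S, ∀ K' ∈ S, min K (2 * n + 3 - K) < min K' (2 * n + 3 - K') →
      ∀ p ∈ G K, ∀ q ∈ G K', φ p < φ q) :
    IsCycleFamily (n + 4) fun i : ZMod (n + 4) => G (S.orderEmbOfFin hcard i) := by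
  have hpair : ∀ a ∈ S, ∀ b ∈ S, ∀ c ∈ S, ∀ d ∈ S,
      (max (min a (2 * n + 3 - a)) (min b (2 * n + 3 - b)) <
        min (min c (2 * n + 3 - c)) (min d (2 * n + 3 - d)) ∨
      max (min c (2 * n + 3 - c)) (min d (2 * n + 3 - d)) <
        min (min a (2 * n + 3 - a)) (min b (2 * n + 3 - b)) ∨
      (a ≤ n + 1 ∧ b ≤ n + 1 ∧ n + 2 ≤ c ∧ n + 2 ≤ d)) →
      convexHull ℝ (G a ∪ G b) ∩ convexHull ℝ (G c ∪ G d) = ∅ := by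
    intro a ha b hb c hc d hd h
    rcases h with h | h | ⟨h4, h5, h6, h7⟩
    · apply convexHull_inter_eq_empty_of_lt φ
      rintro p (hp | hp) q (hq | hq)
      · exact hsep a ha c hc (by omega) p hp q hq
      · exact hsep a ha d hd (by omega) p hp q hq
      · exact hsep b hb c hc (by omega) p hp q hq
      · exact hsep b hb d hd (by omega) p hp q hq
    · rw [Set.inter_comm]
      apply convexHull_inter_eq_empty_of_lt φ
      rintro p (hp | hp) q (hq | hq)
      · exact hsep c hc a ha (by omega) p hp q hq
      · exact hsep c hc b hb (by omega) p hp q hq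
      · exact hsep d hd a ha (by omega) p hp q hq
      · exact hsep d hd b hb (by omega) p hp q hq
    · rw [Set.inter_comm]
      apply convexHull_inter_eq_empty_of_lt ψ
      rintro p (hp | hp) q (hq | hq)
      · exact (hdown c hc h6 p hp).trans (hup a ha h4 q hq)
      · exact (hdown c hc h6 p hp).trans (hup b hb h5 q hq)
      · exact (hdown d hd h7 p hp).trans (hup a ha h4 q hq)
      · exact (hdown d hd h7 p hp).trans (hup b hb h5 q hq)
  have hdisj : ∀ a ∈ S, ∀ b ∈ S, a < b → G a ∩ G b = ∅ := by
    intro a ha b hb hab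
    have h : convexHull ℝ (G a ∪ G a) ∩ convexHull ℝ (G b ∪ G b) = ∅ :=
      hpair a ha a ha b hb b hb (by have := hle b hb; omega)
    rw [← Set.subset_empty_iff, ← h, Set.union_self, Set.union_self]
    exact Set.inter_subset_inter (subset_convexHull ℝ _) (subset_convexHull ℝ _)
  let e := S.orderEmbOfFin hcard
  have hmem : ∀ i, e i ∈ S := S.orderEmbOfFin_mem hcard
  have hsurj : ∀ K ∈ S, ∃ i, e i = K := fun K hK => by
    have : K ∈ Set.range e := by rw [Finset.range_orderEmbOfFin]; exact hK
    exact this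
  have he0 : e 0 = 0 := by
    obtain ⟨i, hi⟩ := hsurj 0 h0
    have := e.monotone (Fin.zero_le i)
    omega
  have helast : e (Fin.last _) = 2 * n + 3 := by
    obtain ⟨i, hi⟩ := hsurj _ h3
    have := e.monotone (Fin.le_last i)
    have := hle _ (hmem (Fin.last _))
    omega
  have hcons : ∀ i j : Fin (n + 4), (j : ℕ) = i + 1 → e i < e j ∧
      (e i ≤ n + 1 → n + 2 ≤ e j → e i = n + 1 ∧ e j = n + 2) := by
    intro i j hij
    refine ⟨e.strictMono (Fin.lt_def.2 (by omega)), fun hi hj => ⟨?_, ?_⟩⟩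
    · obtain ⟨m, hm⟩ := hsurj _ h1
      have hmj : m < j := e.lt_iff_lt.1 (by omega)
      have := e.monotone (a := m) (b := i) (Fin.le_def.2 (by rw [Fin.lt_def] at hmj; omega))
      omega
    · obtain ⟨m, hm⟩ := hsurj _ h2
      have him : i < m := e.lt_iff_lt.1 (by omega)
      have := e.monotone (a := j) (b := m) (Fin.le_def.2 (by rw [Fin.lt_def] at him; omega))
      omega
  have hlt : ∀ i j : Fin (n + 4), i < j → i + 1 ≠ j → i ≠ j + 1 →
      convexHull ℝ (G (e i) ∪ G (e (i + 1))) ∩ convexHull ℝ (G (e j) ∪ G (e (j + 1))) = ∅ := by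
    intro i j hij h4 h5
    have hi : i < Fin.last (n + 3) := hij.trans_le (Fin.le_last j)
    have hi1 : ((i + 1 : Fin (n + 4)) : ℕ) = i + 1 := Fin.val_add_one_of_lt hi
    have hij' : i + 1 < j := by
      refine lt_of_le_of_ne (Fin.le_def.2 ?_) h4
      rw [hi1]; exact hij
    apply hpair _ (hmem _) _ (hmem _) _ (hmem _) _ (hmem _)
    have hc1 := hcons i (i + 1) hi1
    have hc2 := e.strictMono hij'
    rcases (Fin.le_last j).lt_or_eq with hj | rfl
    · have hc3 := hcons j (j + 1) (Fin.val_add_one_of_lt hj)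
      have := hle _ (hmem (j + 1))
      omega
    · rw [Fin.last_add_one] at h5 ⊢
      have hc3 := e.strictMono (Fin.pos_of_ne_zero h5)
      omega
  refine ⟨fun i j hij => ?_, fun i j hij => ?_⟩
  · have hij : G (e i) = G (e j) := hij
    by_contra hne'
    have hself : ∀ i j : Fin (n + 4), i < j → G (e i) ≠ G (e j) := fun i j hlt' heq => by
      have := hdisj _ (hmem i) _ (hmem j) (e.strictMono hlt')
      rw [← heq, Set.inter_self] at this
      exact (hne _ (hmem i)).ne_empty this
    rcases @lt_or_gt_of_ne (Fin (n + 4)) _ i j hne' with h | h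
    · exact hself _ _ h hij
    · exact hself _ _ h hij.symm
  · have hmem' : ∀ z : ZMod (n + 4), z ∈ ({i, i + 1} : Set (ZMod (n + 4))) →
        z ∈ ({j, j + 1} : Set (ZMod (n + 4))) → False := fun z hz hz' => by
      have : z ∈ ({i, i + 1} : Set (ZMod (n + 4))) ∩ {j, j + 1} := ⟨hz, hz'⟩
      rw [hij] at this
      exact this
    have e1 : i ≠ j := fun h => hmem' i (by simp) (by simp [h])
    have e2 : i + 1 ≠ j := fun h => hmem' (i + 1) (by simp) (by simp [h])
    have e3 : i ≠ j + 1 := fun h => hmem' i (by simp) (by simp [h])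
    rcases @lt_or_gt_of_ne (Fin (n + 4)) _ i j e1 with h | h
    · exact hlt i j h e2 e3
    · rw [Set.inter_comm]
      exact hlt j i h (fun h => e3 h.symm) (fun h => e2 h.symm)

/-- If sets on both sides of the line `y = s x + t` lie left of `v`, sets on both sides lie right
of `w`, and `n` further sets missing the line are separated by vertical lines between `v` and `w`,
then these `n + 4` sets form a `C(n + 4)`. -/
theorem exists_isCycleFamily_of_chain {ι : Type*} {A : ι → Set Plane} (hne : ∀ i, (A i).Nonempty)
    {n : ℕ} {s t v w : ℝ} (hvw : v < w) {i₁ j₁ i₂ j₂ : ι}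
    (hi₁ : ∀ p ∈ A i₁, t < p 1 - s * p 0 ∧ p 0 ≤ v)
    (hj₁ : ∀ p ∈ A j₁, p 1 - s * p 0 < t ∧ p 0 ≤ v)
    (hi₂ : ∀ p ∈ A i₂, t < p 1 - s * p 0 ∧ w ≤ p 0)
    (hj₂ : ∀ p ∈ A j₂, p 1 - s * p 0 < t ∧ w ≤ p 0)
    {H : ℕ → ι} (hH : ∀ a < n, ∀ p ∈ A (H a), v < p 0 ∧ p 0 < w)
    (hside : ∀ a < n, (∀ p ∈ A (H a), t < p 1 - s * p 0) ∨ ∀ p ∈ A (H a), p 1 - s * p 0 < t)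
    (hchain : ∀ a b, a < b → b < n → ∀ p ∈ A (H a), ∀ q ∈ A (H b), p 0 < q 0) :
    ∃ F : ZMod (n + 4) → Set Plane, (∀ i, F i ∈ Set.range A) ∧ IsCycleFamily (n + 4) F := by
  classical
  let key : ℕ → ℕ := fun a =>
    if ∀ p ∈ A (H a), t < p 1 - s * p 0 then a + 1 else 2 * n + 2 - a
  let g : ℕ → ι := fun K => if K = 0 then i₁ else if K = n + 1 then i₂ else if K = n + 2 then j₂
    else if K = 2 * n + 3 then j₁ else H (min K (2 * n + 3 - K) - 1)
  let S : Finset ℕ :=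
    insert 0 (insert (n + 1) (insert (n + 2) (insert (2 * n + 3) ((Finset.range n).image key))))
  have hkey : ∀ a < n, (key a = a + 1 ∧ ∀ p ∈ A (H a), t < p 1 - s * p 0) ∨
      (key a = 2 * n + 2 - a ∧ ∀ p ∈ A (H a), p 1 - s * p 0 < t) := by
    intro a ha
    by_cases h : ∀ p ∈ A (H a), t < p 1 - s * p 0
    · exact Or.inl ⟨if_pos h, h⟩
    · exact Or.inr ⟨if_neg h, (hside a ha).resolve_left h⟩
  have hcard : S.card = n + 4 := by
    have hinj : Set.InjOn key (Finset.range n) := by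
      intro a ha b hb hab
      rw [Finset.mem_coe, Finset.mem_range] at ha hb
      rcases hkey a ha with ⟨h, -⟩ | ⟨h, -⟩ <;> rcases hkey b hb with ⟨h', -⟩ | ⟨h', -⟩ <;> omega
    have hnot : ∀ K ∈ (Finset.range n).image key,
        K ≠ 0 ∧ K ≠ n + 1 ∧ K ≠ n + 2 ∧ K ≠ 2 * n + 3 := by
      intro K hK
      obtain ⟨a, ha, rfl⟩ := Finset.mem_image.1 hK
      rw [Finset.mem_range] at ha
      rcases hkey a ha with ⟨h, -⟩ | ⟨h, -⟩ <;> omega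
    rw [Finset.card_insert_of_notMem, Finset.card_insert_of_notMem, Finset.card_insert_of_notMem,
      Finset.card_insert_of_notMem, Finset.card_image_of_injOn hinj, Finset.card_range]
    · exact fun h => (hnot _ h).2.2.2 rfl
    · rw [Finset.mem_insert]
      rintro (h | h)
      · omega
      · exact (hnot _ h).2.2.1 rfl
    · simp only [Finset.mem_insert]
      rintro (h | h | h)
      · omega
      · omega
      · exact (hnot _ h).2.1 rfl
    · simp only [Finset.mem_insert]
      rintro (h | h | h | h)
      · omega
      · omega
      · omega
      · exact (hnot _ h).1 rfl
  have hcases : ∀ K ∈ S, K ≤ 2 * n + 3 ∧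
      ((K ≤ n + 1 ∧ ∀ p ∈ A (g K), t < p 1 - s * p 0) ∨
        (n + 2 ≤ K ∧ ∀ p ∈ A (g K), p 1 - s * p 0 < t)) ∧
      ((min K (2 * n + 3 - K) = 0 ∧ ∀ p ∈ A (g K), p 0 ≤ v) ∨
        (min K (2 * n + 3 - K) = n + 1 ∧ ∀ p ∈ A (g K), w ≤ p 0) ∨
        ∃ a < n, min K (2 * n + 3 - K) = a + 1 ∧ g K = H a) := by
    intro K hK
    simp only [S, Finset.mem_insert] at hK
    rcases hK with rfl | rfl | rfl | rfl | hK
    · have hg : g 0 = i₁ := if_pos rfl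
      rw [hg]
      exact ⟨by omega, Or.inl ⟨by omega, fun p hp => (hi₁ p hp).1⟩,
        Or.inl ⟨by omega, fun p hp => (hi₁ p hp).2⟩⟩
    · have hg : g (n + 1) = i₂ := by simp [g]
      rw [hg]
      exact ⟨by omega, Or.inl ⟨by omega, fun p hp => (hi₂ p hp).1⟩,
        Or.inr (Or.inl ⟨by omega, fun p hp => (hi₂ p hp).2⟩)⟩
    · have hg : g (n + 2) = j₂ := by simp [g]
      rw [hg]
      exact ⟨by omega, Or.inr ⟨by omega, fun p hp => (hj₂ p hp).1⟩,
        Or.inr (Or.inl ⟨by omega, fun p hp => (hj₂ p hp).2⟩)⟩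
    · have hg : g (2 * n + 3) = j₁ := by
        simp only [g]
        rw [if_neg (by omega), if_neg (by omega), if_neg (by omega), if_pos trivial]
      rw [hg]
      exact ⟨by omega, Or.inr ⟨by omega, fun p hp => (hj₁ p hp).1⟩,
        Or.inl ⟨by omega, fun p hp => (hj₁ p hp).2⟩⟩
    · obtain ⟨a, ha, rfl⟩ := Finset.mem_image.1 hK
      rw [Finset.mem_range] at ha
      have hk := hkey a ha
      have hmin : min (key a) (2 * n + 3 - key a) = a + 1 := by
        rcases hk with ⟨h, -⟩ | ⟨h, -⟩ <;> omega
      have hg : g (key a) = H a := by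
        simp only [g]
        rw [hmin]
        rcases hk with ⟨h, -⟩ | ⟨h, -⟩ <;>
          rw [if_neg (by omega), if_neg (by omega), if_neg (by omega), if_neg (by omega)] <;> rfl
      rw [hg]
      refine ⟨by rcases hk with ⟨h, -⟩ | ⟨h, -⟩ <;> omega, ?_, Or.inr (Or.inr ⟨a, ha, hmin, rfl⟩)⟩
      rcases hk with ⟨h, h'⟩ | ⟨h, h'⟩
      · exact Or.inl ⟨by omega, h'⟩
      · exact Or.inr ⟨by omega, h'⟩
  refine ⟨_, fun i => ⟨_, rfl⟩, isCycleFamily_of_keys (S := S) hcard (by simp [S]) (by simp [S])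
    (by simp [S]) (by simp [S]) (fun K hK => (hcases K hK).1)
    (EuclideanSpace.proj (0 : Fin 2) : Plane →L[ℝ] ℝ).toLinearMap
    ((EuclideanSpace.proj (1 : Fin 2) : Plane →L[ℝ] ℝ).toLinearMap -
      s • (EuclideanSpace.proj (0 : Fin 2) : Plane →L[ℝ] ℝ).toLinearMap)
    t (fun K => A (g K)) (fun K _ => hne _) ?_ ?_ ?_⟩
  · intro K hK hKn p hp
    rcases (hcases K hK).2.1 with ⟨-, h⟩ | ⟨h, -⟩
    · exact h p hp
    · omega
  · intro K hK hKn p hp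
    rcases (hcases K hK).2.1 with ⟨h, -⟩ | ⟨-, h⟩
    · omega
    · exact h p hp
  · intro K hK K' hK' hlt p hp q hq
    change p 0 < q 0
    rcases (hcases K hK).2.2 with ⟨h, h1⟩ | ⟨h, h1⟩ | ⟨a, ha, h, h1⟩ <;>
      rcases (hcases K' hK').2.2 with ⟨h', h2⟩ | ⟨h', h2⟩ | ⟨b, hb, h', h2⟩ <;> try omega
    · linarith [h1 p hp, h2 q hq]
    · rw [h2] at hq
      linarith [h1 p hp, (hH b hb q hq).1]
    · rw [h1] at hp
      linarith [h2 q hq, (hH a ha p hp).2]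
    · rw [h1] at hp
      rw [h2] at hq
      exact hchain a b (by omega) hb p hp q hq

/-! ### Piercing intervals greedily -/

/-- Intervals `[lo i, hi i]`: either `m` of them are pairwise disjoint, or fewer than `m` points
pierce them all. The greedy choice is an interval with the leftmost right end point. -/
theorem exists_chain_or_piercing {ι : Type*} [Nonempty ι] (lo hi : ι → ℝ)
    (m : ℕ) (T : Finset ι) (hlohi : ∀ i ∈ T, lo i ≤ hi i) :
    (∃ H : ℕ → ι, (∀ a < m, H a ∈ T) ∧ ∀ a b, a < b → b < m → hi (H a) < lo (H b)) ∨
      ∃ X : Finset ℝ, X.card < m ∧ ∀ i ∈ T, ∃ x ∈ X, lo i ≤ x ∧ x ≤ hi i := by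
  classical
  induction m generalizing T with
  | zero => exact Or.inl ⟨fun _ => Classical.arbitrary ι, by simp, by simp⟩
  | succ m ih =>
    rcases T.eq_empty_or_nonempty with rfl | hT
    · exact Or.inr ⟨∅, by simp, by simp⟩
    obtain ⟨i₀, hi₀, hmin⟩ := T.exists_min_image hi hT
    rcases ih (T.filter fun i => hi i₀ < lo i)
      (fun i hiT => hlohi i (Finset.mem_filter.1 hiT).1) with ⟨H, hH, hlt⟩ | ⟨X, hX, hpierce⟩
    · refine Or.inl ⟨fun a => Nat.casesOn a i₀ H, ?_, ?_⟩
      · rintro (_ | a) ha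
        · exact hi₀
        · exact (Finset.mem_filter.1 (hH a (by omega))).1
      · rintro (_ | a) (_ | b) hab hb
        · omega
        · exact (Finset.mem_filter.1 (hH b (by omega))).2
        · omega
        · exact hlt a b (by omega) (by omega)
    · refine Or.inr ⟨insert (hi i₀) X, (Finset.card_insert_le _ _).trans_lt (by omega), ?_⟩
      intro i hiT
      by_cases h : hi i₀ < lo i
      · obtain ⟨x, hx, h'⟩ := hpierce i (Finset.mem_filter.2 ⟨hiT, h⟩)
        exact ⟨x, Finset.mem_insert_of_mem hx, h'⟩
      · exact ⟨hi i₀, Finset.mem_insert_self _ _, not_lt.1 h, hmin i hiT⟩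

/-! ### Balanced heights -/

/-- Let `[P i, Q i]` be intervals ordered by the key `κ`. As `t` grows, the first interval above `t`
comes later and later, the first interval below `t` earlier and earlier; this is the height at which
they change places. As a finite maximum of minima it depends continuously on `P` and `Q`. -/
noncomputable def balancedHeight {ι : Type*} [Fintype ι] [Nonempty ι] (κ P Q : ι → ℝ) : ℝ :=
  Finset.univ.sup' Finset.univ_nonempty fun i =>
    Finset.univ.inf' Finset.univ_nonempty fun j => if κ j < κ i then Q j else P i

section balancedHeight

variable {ι : Type*} [Fintype ι] [Nonempty ι] {κ P Q : ι → ℝ}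

theorem continuous_balancedHeight {P Q : ℝ → ι → ℝ} (hP : ∀ i, Continuous fun s => P s i)
    (hQ : ∀ i, Continuous fun s => Q s i) :
    Continuous fun s => balancedHeight κ (P s) (Q s) := by
  refine Continuous.finset_sup'_apply _ fun i _ => Continuous.finset_inf'_apply _ fun j _ => ?_
  split_ifs
  · exact hQ j
  · exact hP i

theorem le_balancedHeight {i₀ : ι} (h : ∀ i, κ i₀ ≤ κ i) : P i₀ ≤ balancedHeight κ P Q := by
  refine le_trans ?_ (Finset.le_sup' _ (Finset.mem_univ i₀))
  refine Finset.le_inf' _ _ fun j _ => ?_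
  rw [if_neg (not_lt.2 (h j))]

theorem balancedHeight_le {i₀ : ι} {B : ℝ} (hQ : Q i₀ ≤ B) (hP : ∀ i, κ i ≤ κ i₀ → P i ≤ B) :
    balancedHeight κ P Q ≤ B := by
  refine Finset.sup'_le _ _ fun i _ => (Finset.inf'_le _ (Finset.mem_univ i₀)).trans ?_
  split_ifs with h
  · exact hQ
  · exact hP i (not_lt.1 h)

/-- At the balanced height, every interval before the first moment at which there are intervals on
both sides contains the height. -/
theorem balancedHeight_spec {t : ℝ} (ht : balancedHeight κ P Q = t) :
    (∀ l, P l ≤ t ∧ t ≤ Q l) ∨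
      ∃ i j, t ≤ P i ∧ Q j ≤ t ∧ ∀ l, κ l < max (κ i) (κ j) → P l ≤ t ∧ t ≤ Q l := by
  classical
  have h1 : ∃ i, t ≤ P i ∧ ∀ j, κ j < κ i → t ≤ Q j := by
    obtain ⟨i, -, hi⟩ := Finset.exists_mem_eq_sup' (Finset.univ_nonempty (α := ι)) fun i =>
      Finset.univ.inf' Finset.univ_nonempty fun j => if κ j < κ i then Q j else P i
    have hle : ∀ j, t ≤ if κ j < κ i then Q j else P i := fun j => by
      rw [← ht, balancedHeight, hi]
      exact Finset.inf'_le _ (Finset.mem_univ j)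
    exact ⟨i, by simpa using hle i, fun j hj => by simpa [hj] using hle j⟩
  have h2 : ∀ l, t < P l → ∃ j, κ j < κ l ∧ Q j ≤ t := by
    intro l hl
    obtain ⟨j, -, hj⟩ := Finset.exists_mem_eq_inf' (Finset.univ_nonempty (α := ι)) fun j =>
      if κ j < κ l then Q j else P l
    have hle : (if κ j < κ l then Q j else P l) ≤ t := by
      rw [← ht, ← hj]
      exact Finset.le_sup' (fun i => Finset.univ.inf' Finset.univ_nonempty fun j =>
        if κ j < κ i then Q j else P i) (Finset.mem_univ l)
    by_cases h : κ j < κ l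
    · exact ⟨j, h, by simpa [h] using hle⟩
    · rw [if_neg h] at hle
      linarith
  -- An interval missing `t` comes no earlier than some pair of intervals on both sides of `t`.
  have h3 : ∀ l, ¬ (P l ≤ t ∧ t ≤ Q l) →
      ∃ i j, t ≤ P i ∧ Q j ≤ t ∧ max (κ i) (κ j) ≤ κ l := by
    intro l hl
    rcases not_and_or.1 hl with h | h
    · obtain ⟨j, hj, hj'⟩ := h2 l (not_le.1 h)
      exact ⟨l, j, (not_le.1 h).le, hj', max_le le_rfl hj.le⟩
    · obtain ⟨i, hi, hi'⟩ := h1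
      exact ⟨i, l, hi, (not_le.1 h).le, max_le (not_lt.1 fun hlt => h (hi' l hlt)) le_rfl⟩
  by_cases hall : ∀ l, P l ≤ t ∧ t ≤ Q l
  · exact Or.inl hall
  obtain ⟨l, hl⟩ := not_forall.1 hall
  obtain ⟨i', j', hi', hj', -⟩ := h3 l hl
  obtain ⟨⟨i, j⟩, hij, hmin⟩ := (Finset.univ.filter fun z : ι × ι => t ≤ P z.1 ∧ Q z.2 ≤ t)
    |>.exists_min_image (fun z => max (κ z.1) (κ z.2)) ⟨(i', j'), by simp [hi', hj']⟩
  simp only [Finset.mem_filter, Finset.mem_univ, true_and] at hij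
  refine Or.inr ⟨i, j, hij.1, hij.2, fun l hlt => ?_⟩
  by_contra hl
  obtain ⟨i', j', hi', hj', hle⟩ := h3 l hl
  exact absurd (hmin (i', j') (by simp [hi', hj'])) (not_le.2 (hle.trans_lt hlt))

end balancedHeight

/-! ### Finite families -/

theorem exists_abs_sub_le_of_convex {A : Set Plane} (hA : Convex ℝ A) {f : Plane → ℝ}
    (hf : Continuous f) {a b : Plane} (ha : a ∈ A) (hb : b ∈ A) {t ε : ℝ} (hε : 0 ≤ ε)
    (h1 : f a - ε ≤ t) (h2 : t ≤ f b + ε) : ∃ p ∈ A, |f p - t| ≤ ε := by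
  rcases le_total t (f a) with h | h
  · exact ⟨a, ha, abs_le.2 ⟨by linarith, by linarith⟩⟩
  rcases le_total (f b) t with h' | h'
  · exact ⟨b, hb, abs_le.2 ⟨by linarith, by linarith⟩⟩
  obtain ⟨p, hp, hpt⟩ := hA.isPreconnected.intermediate_value ha hb hf.continuousOn ⟨h, h'⟩
  exact ⟨p, hp, by rw [hpt, sub_self, abs_zero]; exact hε⟩

/-- A finite family without a `C(n + 4)` has `n + 2` lines that come arbitrarily close to all of its
members. The line `a x + b y + c = 0` is recorded by its coefficients. -/
theorem exists_lines_near_of_finite {n : ℕ} {ι : Type*} [Finite ι] {A : ι → Set Plane}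
    (hne : ∀ i, (A i).Nonempty) (hcomp : ∀ i, IsCompact (A i)) (hconv : ∀ i, Convex ℝ (A i))
    (hfree : ¬ ∃ F : ZMod (n + 4) → Set Plane,
      (∀ i, F i ∈ Set.range A) ∧ IsCycleFamily (n + 4) F) {ε : ℝ} (hε : 0 < ε) :
    ∃ T : Finset (ℝ × ℝ × ℝ), T.card ≤ n + 2 ∧ (∀ l ∈ T, 1 ≤ ‖l‖) ∧
      ∀ i, ∃ l ∈ T, ∃ p ∈ A i, |l.1 * p 0 + l.2.1 * p 1 + l.2.2| ≤ ε := by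
  classical
  rcases isEmpty_or_nonempty ι with hι | hι
  · exact ⟨∅, by simp, by simp, fun i => hι.elim i⟩
  have := Fintype.ofFinite ι
  have hx : Continuous fun p : Plane => p 0 := by fun_prop
  have hy : Continuous fun p : Plane => p 1 := by fun_prop
  have hxy : ∀ s : ℝ, Continuous fun p : Plane => p 1 - s * p 0 := fun s => by fun_prop
  -- The horizontal extent `[lo i, hi i]` of the sets.
  choose xl hxl hlo using fun i => (hcomp i).exists_isMinOn (hne i) hx.continuousOn
  choose xr hxr hhi using fun i => (hcomp i).exists_isMaxOn (hne i) hx.continuousOn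
  let lo : ι → ℝ := fun i => xl i 0
  let hi : ι → ℝ := fun i => xr i 0
  have hlo' : ∀ i, ∀ p ∈ A i, lo i ≤ p 0 := fun i p hp => hlo i hp
  have hhi' : ∀ i, ∀ p ∈ A i, p 0 ≤ hi i := fun i p hp => hhi i hp
  -- The set `A i` meets `y = s x + t` if and only if `m s i ≤ t ≤ M s i`.
  let m : ℝ → ι → ℝ := fun s i => sInf ((fun p : Plane => p 1 - s * p 0) '' A i)
  let M : ℝ → ι → ℝ := fun s i => sSup ((fun p : Plane => p 1 - s * p 0) '' A i)
  have hm : ∀ s i, ∃ p ∈ A i, p 1 - s * p 0 = m s i := fun s i =>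
    ((hcomp i).image (hxy s)).sInf_mem ((hne i).image _)
  have hM : ∀ s i, ∃ p ∈ A i, p 1 - s * p 0 = M s i := fun s i =>
    ((hcomp i).image (hxy s)).sSup_mem ((hne i).image _)
  have hm' : ∀ s i, ∀ p ∈ A i, m s i ≤ p 1 - s * p 0 := fun s i p hp =>
    csInf_le ((hcomp i).image (hxy s)).bddBelow ⟨p, hp, rfl⟩
  have hM' : ∀ s i, ∀ p ∈ A i, p 1 - s * p 0 ≤ M s i := fun s i p hp =>
    le_csSup ((hcomp i).image (hxy s)).bddAbove ⟨p, hp, rfl⟩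
  have hcont : Continuous (Function.uncurry fun (s : ℝ) (p : Plane) => p 1 - s * p 0) := by
    simp only [Function.uncurry_def]
    fun_prop
  have hmc : ∀ i, Continuous fun s => m s i - ε := fun i =>
    ((hcomp i).continuous_sInf hcont).sub continuous_const
  have hMc : ∀ i, Continuous fun s => M s i + ε := fun i =>
    ((hcomp i).continuous_sSup hcont).add continuous_const
  -- Vertical lines, and lines of slope `s`.
  let V : ℝ → ℝ × ℝ × ℝ := fun v => (1, 0, -v)
  have hVnorm : ∀ v, 1 ≤ ‖V v‖ := fun v => by
    simpa only [V, norm_one] using norm_fst_le (V v)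
  have hV : ∀ v i, lo i ≤ v → v ≤ hi i →
      ∃ p ∈ A i, |(V v).1 * p 0 + (V v).2.1 * p 1 + (V v).2.2| ≤ ε := by
    intro v i h1 h2
    obtain ⟨p, hp, h⟩ := exists_abs_sub_le_of_convex (hconv i) hx (hxl i) (hxr i) hε.le
      (by change lo i - ε ≤ v; linarith) (by change v ≤ hi i + ε; linarith)
    refine ⟨p, hp, ?_⟩
    rwa [show (V v).1 * p 0 + (V v).2.1 * p 1 + (V v).2.2 = p 0 - v by simp only [V]; ring]
  let ℓ : ℝ → ℝ → ℝ × ℝ × ℝ := fun s t => (-s, 1, -t)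
  have hlnorm : ∀ s t, 1 ≤ ‖ℓ s t‖ := fun s t => by
    have h1 := norm_snd_le (ℓ s t)
    have h2 := norm_fst_le (ℓ s t).2
    simp only [ℓ, norm_one] at h1 h2 ⊢
    exact h2.trans h1
  have hℓ : ∀ s t i, m s i - ε ≤ t → t ≤ M s i + ε →
      ∃ p ∈ A i, |(ℓ s t).1 * p 0 + (ℓ s t).2.1 * p 1 + (ℓ s t).2.2| ≤ ε := by
    intro s t i h1 h2
    obtain ⟨a, ha, ha'⟩ := hm s i
    obtain ⟨b, hb, hb'⟩ := hM s i
    obtain ⟨p, hp, h⟩ := exists_abs_sub_le_of_convex (hconv i) (hxy s) ha hb (t := t) hε.le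
      (by rwa [ha']) (by rwa [hb'])
    refine ⟨p, hp, ?_⟩
    rwa [show (ℓ s t).1 * p 0 + (ℓ s t).2.1 * p 1 + (ℓ s t).2.2 = p 1 - s * p 0 - t by
      simp only [ℓ]; ring]
  have hone : ∀ l : ℝ × ℝ × ℝ, 1 ≤ ‖l‖ →
      (∀ i, ∃ p ∈ A i, |l.1 * p 0 + l.2.1 * p 1 + l.2.2| ≤ ε) →
      ∃ T : Finset (ℝ × ℝ × ℝ), T.card ≤ n + 2 ∧ (∀ l ∈ T, 1 ≤ ‖l‖) ∧
        ∀ i, ∃ l ∈ T, ∃ p ∈ A i, |l.1 * p 0 + l.2.1 * p 1 + l.2.2| ≤ ε := fun l hl h =>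
    ⟨{l}, by simp, by simpa using hl, fun i => ⟨l, by simp, h i⟩⟩
  -- The set ending first and the set starting last.
  obtain ⟨i₀, -, hi₀⟩ := Finset.univ.exists_min_image hi Finset.univ_nonempty
  obtain ⟨j₀, -, hj₀⟩ := Finset.univ.exists_max_image lo Finset.univ_nonempty
  rcases le_or_gt (lo j₀) (hi i₀) with hle | hgt
  · exact hone (V (hi i₀)) (hVnorm _) fun i => hV _ i ((hj₀ i (Finset.mem_univ i)).trans hle)
      (hi₀ i (Finset.mem_univ i))
  obtain ⟨Y, hY⟩ : ∃ Y, ∀ i, ∀ p ∈ A i, |p 1| ≤ Y := by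
    obtain ⟨Y, hY⟩ := (isCompact_iUnion hcomp).exists_bound_of_continuousOn hy.continuousOn
    exact ⟨Y, fun i p hp => hY p (Set.mem_iUnion_of_mem i hp)⟩
  have hY0 : 0 ≤ Y := by
    obtain ⟨p, hp⟩ := hne i₀
    exact (abs_nonneg _).trans (hY i₀ p hp)
  let tL : ℝ → ℝ := fun s => balancedHeight hi (fun i => m s i - ε) fun i => M s i + ε
  let tR : ℝ → ℝ := fun s => balancedHeight (fun i => -lo i) (fun i => m s i - ε) fun i => M s i + ε
  -- A steep line is balanced on the left near the right end of `A i₀`, and on the right near the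
  -- left end of `A j₀`; so the two heights change their order as the slope changes its sign.
  have hposL : ∀ s, 0 ≤ s → -s * hi i₀ - Y - ε ≤ tL s := by
    intro s hs
    refine le_trans ?_ (le_balancedHeight fun i => hi₀ i (Finset.mem_univ i))
    obtain ⟨p, hp, hp'⟩ := hm s i₀
    rw [← hp']
    nlinarith [mul_le_mul_of_nonneg_left (hhi' i₀ p hp) hs, (abs_le.1 (hY i₀ p hp)).1]
  have hposR : ∀ s, 0 ≤ s → tR s ≤ -s * lo j₀ + Y + ε := by
    intro s hs
    refine balancedHeight_le (i₀ := j₀) ?_ fun i hij => ?_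
    · obtain ⟨p, hp, hp'⟩ := hM s j₀
      rw [← hp']
      nlinarith [mul_le_mul_of_nonneg_left (hlo' j₀ p hp) hs, (abs_le.1 (hY j₀ p hp)).2]
    · obtain ⟨p, hp, hp'⟩ := hm s i
      rw [← hp']
      nlinarith [mul_le_mul_of_nonneg_left ((neg_le_neg_iff.1 hij).trans (hlo' i p hp)) hs,
        (abs_le.1 (hY i p hp)).2]
  have hnegL : ∀ s, 0 ≤ s → tL (-s) ≤ s * hi i₀ + Y + ε := by
    intro s hs
    refine balancedHeight_le (i₀ := i₀) ?_ fun i hij => ?_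
    · obtain ⟨p, hp, hp'⟩ := hM (-s) i₀
      rw [← hp']
      nlinarith [mul_le_mul_of_nonneg_left (hhi' i₀ p hp) hs, (abs_le.1 (hY i₀ p hp)).2]
    · obtain ⟨p, hp, hp'⟩ := hm (-s) i
      rw [← hp']
      nlinarith [mul_le_mul_of_nonneg_left ((hhi' i p hp).trans hij) hs,
        (abs_le.1 (hY i p hp)).2]
  have hnegR : ∀ s, 0 ≤ s → s * lo j₀ - Y - ε ≤ tR (-s) := by
    intro s hs
    refine le_trans ?_ (le_balancedHeight (i₀ := j₀) fun i =>
      neg_le_neg (hj₀ i (Finset.mem_univ i)))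
    obtain ⟨p, hp, hp'⟩ := hm (-s) j₀
    rw [← hp']
    nlinarith [mul_le_mul_of_nonneg_left (hlo' j₀ p hp) hs, (abs_le.1 (hY j₀ p hp)).1]
  obtain ⟨s, hs⟩ : ∃ s, tL s = tR s := by
    have hd : 0 < lo j₀ - hi i₀ := by linarith
    set σ := (2 * Y + 2 * ε) / (lo j₀ - hi i₀)
    have hσ0 : 0 ≤ σ := by positivity
    have hσd : σ * (lo j₀ - hi i₀) = 2 * Y + 2 * ε := div_mul_cancel₀ _ hd.ne'
    have hc : Continuous fun s => tL s - tR s :=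
      (continuous_balancedHeight hmc hMc).sub (continuous_balancedHeight hmc hMc)
    obtain ⟨s, -, hs⟩ := intermediate_value_Icc (show -σ ≤ σ by linarith) hc.continuousOn
      (show (0 : ℝ) ∈ Set.Icc _ _ from
        ⟨by linarith [hnegL σ hσ0, hnegR σ hσ0], by linarith [hposL σ hσ0, hposR σ hσ0]⟩)
    exact ⟨s, sub_eq_zero.1 hs⟩
  obtain ⟨t, htL⟩ : ∃ t, tL s = t := ⟨_, rfl⟩
  have htR : tR s = t := by rw [← hs, htL]
  rcases balancedHeight_spec htL with hall | ⟨i₁, j₁, hi₁, hj₁, hleft⟩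
  · exact hone (ℓ s t) (hlnorm _ _) fun i => hℓ s t i (hall i).1 (hall i).2
  rcases balancedHeight_spec htR with hall | ⟨i₂, j₂, hi₂, hj₂, hright⟩
  · exact hone (ℓ s t) (hlnorm _ _) fun i => hℓ s t i (hall i).1 (hall i).2
  set v := max (hi i₁) (hi j₁)
  obtain ⟨w, hw⟩ : ∃ w, w = -max (-lo i₂) (-lo j₂) := ⟨_, rfl⟩
  have hright : ∀ l, w < lo l → m s l - ε ≤ t ∧ t ≤ M s l + ε := fun l hl =>
    hright l (by linarith)
  rcases le_or_gt w v with hwv | hvw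
  · refine ⟨{ℓ s t, V v}, (Finset.card_le_two).trans (by omega), ?_, fun i => ?_⟩
    · intro l hl
      rcases Finset.mem_insert.1 hl with rfl | hl
      · exact hlnorm _ _
      · rw [Finset.mem_singleton.1 hl]; exact hVnorm _
    · by_cases h1 : hi i < v
      · exact ⟨ℓ s t, by simp, hℓ s t i (hleft i h1).1 (hleft i h1).2⟩
      by_cases h2 : w < lo i
      · exact ⟨ℓ s t, by simp, hℓ s t i (hright i h2).1 (hright i h2).2⟩
      · exact ⟨V v, by simp, hV v i ((not_lt.1 h2).trans hwv) (not_lt.1 h1)⟩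
  let mid : Finset ι := Finset.univ.filter fun l =>
    v < lo l ∧ hi l < w ∧ ¬ (m s l - ε ≤ t ∧ t ≤ M s l + ε)
  rcases exists_chain_or_piercing lo hi n mid fun i _ => hlo' i _ (hxr i) with
    ⟨H, hH, hchain⟩ | ⟨X, hX, hpierce⟩
  · exfalso
    apply hfree
    have hH' : ∀ a < n, v < lo (H a) ∧ hi (H a) < w ∧
        ¬ (m s (H a) - ε ≤ t ∧ t ≤ M s (H a) + ε) := fun a ha => (Finset.mem_filter.1 (hH a ha)).2
    have hw1 : w ≤ lo i₂ := by linarith [le_max_left (-lo i₂) (-lo j₂)]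
    have hw2 : w ≤ lo j₂ := by linarith [le_max_right (-lo i₂) (-lo j₂)]
    refine exists_isCycleFamily_of_chain (A := A) hne (s := s) (t := t) hvw
      (i₁ := i₁) (j₁ := j₁) (i₂ := i₂) (j₂ := j₂) (fun p hp => ⟨?_, ?_⟩) (fun p hp => ⟨?_, ?_⟩)
      (fun p hp => ⟨?_, ?_⟩) (fun p hp => ⟨?_, ?_⟩) (H := H) (fun a ha p hp => ⟨?_, ?_⟩)
      (fun a ha => ?_) fun a b hab hb p hp q hq => ?_
    · linarith [hm' s i₁ p hp]
    · exact (hhi' i₁ p hp).trans (le_max_left _ _)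
    · linarith [hM' s j₁ p hp]
    · exact (hhi' j₁ p hp).trans (le_max_right _ _)
    · linarith [hm' s i₂ p hp]
    · exact hw1.trans (hlo' i₂ p hp)
    · linarith [hM' s j₂ p hp]
    · exact hw2.trans (hlo' j₂ p hp)
    · exact (hH' a ha).1.trans_le (hlo' _ p hp)
    · exact (hhi' _ p hp).trans_lt (hH' a ha).2.1
    · rcases not_and_or.1 (hH' a ha).2.2 with h | h
      · exact Or.inl fun p hp => by linarith [hm' s _ p hp]
      · exact Or.inr fun p hp => by linarith [hM' s _ p hp]
    · linarith [hchain a b hab hb, hhi' _ p hp, hlo' _ q hq]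
  · refine ⟨insert (ℓ s t) (insert (V v) (insert (V w) (X.image V))), ?_, ?_, fun i => ?_⟩
    · have h1 := Finset.card_insert_le (ℓ s t) (insert (V v) (insert (V w) (X.image V)))
      have h2 := Finset.card_insert_le (V v) (insert (V w) (X.image V))
      have h3 := Finset.card_insert_le (V w) (X.image V)
      have h4 := Finset.card_image_le (s := X) (f := V)
      omega
    · intro l hl
      simp only [Finset.mem_insert, Finset.mem_image] at hl
      rcases hl with rfl | rfl | rfl | ⟨x, -, rfl⟩
      · exact hlnorm _ _
      · exact hVnorm _
      · exact hVnorm _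
      · exact hVnorm _
    · by_cases hhit : m s i - ε ≤ t ∧ t ≤ M s i + ε
      · exact ⟨ℓ s t, by simp, hℓ s t i hhit.1 hhit.2⟩
      have h1 : v ≤ hi i := not_lt.1 fun h => hhit (hleft i h)
      have h2 : lo i ≤ w := not_lt.1 fun h => hhit (hright i h)
      rcases le_or_gt (lo i) v with h3 | h3
      · exact ⟨V v, by simp, hV v i h3 h1⟩
      rcases le_or_gt w (hi i) with h4 | h4
      · exact ⟨V w, by simp, hV w i h2 h4⟩
      obtain ⟨x, hx, hx1, hx2⟩ := hpierce i (Finset.mem_filter.2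
        ⟨Finset.mem_univ i, h3, h4, hhit⟩)
      refine ⟨V x, ?_, hV x i hx1 hx2⟩
      simp only [Finset.mem_insert, Finset.mem_image]
      exact Or.inr (Or.inr (Or.inr ⟨x, hx, rfl⟩))

/-! ### Compactness -/

/-- The points of the plane on `a x + b y + c = 0` lie on a line as soon as `(a, b, c) ≠ 0`. -/
theorem exists_isLine_of_equation {l : ℝ × ℝ × ℝ} (hl : l ≠ 0) :
    ∃ L : AffineSubspace ℝ Plane, IsLine L ∧
      ∀ p : Plane, l.1 * p 0 + l.2.1 * p 1 + l.2.2 = 0 → p ∈ L := by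
  obtain ⟨a, b, c⟩ := l
  have hmk : ∀ (q d : Plane), d ≠ 0 → IsLine (AffineSubspace.mk' q (Submodule.span ℝ {d})) :=
    fun q d hd => by
      rw [IsLine, AffineSubspace.direction_mk']
      exact finrank_span_singleton hd
  by_cases hex : ∃ q : Plane, a * q 0 + b * q 1 + c = 0
  · obtain ⟨q, hq⟩ := hex
    have hab : ¬ (a = 0 ∧ b = 0) := by
      rintro ⟨rfl, rfl⟩
      apply hl
      have : c = 0 := by simpa using hq
      rw [this]
      rfl
    have hab2 : a ^ 2 + b ^ 2 ≠ 0 := fun h => hab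
      ⟨by nlinarith [sq_nonneg a, sq_nonneg b], by nlinarith [sq_nonneg a, sq_nonneg b]⟩
    refine ⟨AffineSubspace.mk' q (Submodule.span ℝ {!₂[-b, a]}), hmk _ _ fun h => hab ?_,
      fun p hp => ?_⟩
    · have h0 : -b = 0 := by simpa using congrArg (fun z : Plane => z 0) h
      have h1 : a = 0 := by simpa using congrArg (fun z : Plane => z 1) h
      exact ⟨h1, neg_eq_zero.1 h0⟩
    · rw [AffineSubspace.mem_mk', Submodule.mem_span_singleton]
      refine ⟨(a * (p 1 - q 1) - b * (p 0 - q 0)) / (a ^ 2 + b ^ 2), ?_⟩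
      have hpq : a * (p 0 - q 0) + b * (p 1 - q 1) = 0 := by
        have hp : a * p 0 + b * p 1 + c = 0 := hp
        linear_combination hp - hq
      ext i
      fin_cases i
      · simp
        field_simp
        linear_combination (-a) * hpq
      · simp
        field_simp
        linear_combination (-b) * hpq
  · refine ⟨_, hmk 0 !₂[1, 0] fun h => ?_, fun p hp => (hex ⟨p, hp⟩).elim⟩
    have h0 : (1 : ℝ) = 0 := by simpa using congrArg (fun z : Plane => z 0) h
    exact one_ne_zero h0

/-- The `n`-tuples of unit coefficient vectors form a compact space, in which coming within `ε` of a
given compact set is a closed condition; so it suffices to treat finite subfamilies with `ε > 0`. -/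
theorem mem_sufficientLineNumbers (n : ℕ) : n + 2 ∈ sufficientLineNumbers (n + 4) := by
  classical
  intro 𝓕 h𝓕 hfree
  let f : ℝ × ℝ × ℝ → Plane → ℝ := fun l p => |l.1 * p 0 + l.2.1 * p 1 + l.2.2|
  have hf : Continuous (Function.uncurry f) := by
    simp only [f, Function.uncurry_def]
    fun_prop
  let D : Set Plane → ℝ × ℝ × ℝ → ℝ := fun A l => sInf (f l '' A)
  have hD : ∀ A ∈ 𝓕, Continuous (D A) := fun A hA => (h𝓕 A hA).2.1.continuous_sInf hf
  have hfl : ∀ l, Continuous (f l) := fun l => hf.comp (Continuous.prodMk_right l)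
  have hDle : ∀ A ∈ 𝓕, ∀ l, ∀ p ∈ A, D A l ≤ f l p := fun A hA l p hp =>
    csInf_le ((h𝓕 A hA).2.1.image (hfl l)).bddBelow ⟨p, hp, rfl⟩
  have hDmem : ∀ A ∈ 𝓕, ∀ l, ∃ p ∈ A, f l p = D A l := fun A hA l =>
    ((h𝓕 A hA).2.1.image (hfl l)).sInf_mem ((h𝓕 A hA).1.image _)
  let K : Set (Fin (n + 2) → ℝ × ℝ × ℝ) := Set.univ.pi fun _ => Metric.sphere 0 1
  have hK : IsCompact K := isCompact_univ_pi fun _ => isCompact_sphere 0 1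
  let C : 𝓕 × ℕ → Set (Fin (n + 2) → ℝ × ℝ × ℝ) := fun z =>
    ⋃ i, {l | D z.1 (l i) ≤ 1 / ((z.2 : ℝ) + 1)}
  have hC : ∀ z, IsClosed (C z) := fun z => isClosed_iUnion_of_finite fun i =>
    isClosed_le ((hD z.1 z.1.2).comp (continuous_apply i)) continuous_const
  have hfin : ∀ u : Finset (𝓕 × ℕ), (K ∩ ⋂ z ∈ u, C z).Nonempty := by
    intro u
    let N := u.sup Prod.snd
    let A : u.image Prod.fst → Set Plane := fun z => z.1.1
    have hA : ∀ z, A z ∈ 𝓕 := fun z => z.1.2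
    obtain ⟨T, hcard, hnorm, hT⟩ := exists_lines_near_of_finite (n := n) (A := A)
      (fun z => (h𝓕 _ (hA z)).1) (fun z => (h𝓕 _ (hA z)).2.1) (fun z => (h𝓕 _ (hA z)).2.2)
      (fun ⟨F, hF, hF'⟩ => hfree ⟨F, fun i => by
        obtain ⟨z, hz⟩ := hF i
        rw [← hz]
        exact hA z, hF'⟩) (ε := 1 / ((N : ℝ) + 1)) (by positivity)
    let l : Fin (n + 2) → ℝ × ℝ × ℝ := fun i => T.toList.getD i (1, 0, 0)
    have hl1 : ∀ i, 1 ≤ ‖l i‖ := by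
      intro i
      by_cases hi : (i : ℕ) < T.toList.length
      · refine hnorm _ ?_
        rw [← Finset.mem_toList]
        simp only [l, List.getD_eq_getElem _ _ hi]
        exact List.getElem_mem hi
      · simp only [l, List.getD_eq_default _ _ (not_lt.1 hi)]
        simpa only [norm_one] using norm_fst_le ((1, 0, 0) : ℝ × ℝ × ℝ)
    refine ⟨fun i => ‖l i‖⁻¹ • l i, fun i _ => ?_, Set.mem_iInter₂.2 fun z hz => ?_⟩
    · have : ‖l i‖ ≠ 0 := by linarith [hl1 i]
      rw [mem_sphere_zero_iff_norm, norm_smul, norm_inv, norm_norm, inv_mul_cancel₀ this]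
    · obtain ⟨l', hl', p, hp, hlp⟩ := hT ⟨z.1, Finset.mem_image_of_mem _ hz⟩
      obtain ⟨i, hi, rfl⟩ := List.getElem_of_mem (Finset.mem_toList.2 hl')
      have hi' : i < n + 2 := by
        rw [Finset.length_toList] at hi
        omega
      refine Set.mem_iUnion.2 ⟨⟨i, hi'⟩, ?_⟩
      have hli : l ⟨i, hi'⟩ = T.toList[i] := List.getD_eq_getElem _ _ hi
      have h1 := hl1 ⟨i, hi'⟩
      rw [← hli] at hlp
      have hN : (z.2 : ℝ) ≤ N := by exact_mod_cast Finset.le_sup (f := Prod.snd) hz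
      calc D z.1 (‖l ⟨i, hi'⟩‖⁻¹ • l ⟨i, hi'⟩)
          ≤ f (‖l ⟨i, hi'⟩‖⁻¹ • l ⟨i, hi'⟩) p := hDle _ z.1.2 _ p hp
        _ = ‖l ⟨i, hi'⟩‖⁻¹ * f (l ⟨i, hi'⟩) p := by
          simp only [f, Prod.smul_fst, Prod.smul_snd, smul_eq_mul]
          rw [← abs_of_nonneg (inv_nonneg.2 (norm_nonneg (l ⟨i, hi'⟩))), ← abs_mul]
          simp only [abs_of_nonneg (inv_nonneg.2 (norm_nonneg (l ⟨i, hi'⟩)))]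
          congr 1
          ring
        _ ≤ 1 * f (l ⟨i, hi'⟩) p :=
          mul_le_mul_of_nonneg_right (inv_le_one_of_one_le₀ h1) (abs_nonneg _)
        _ ≤ 1 / ((N : ℝ) + 1) := by rw [one_mul]; exact hlp
        _ ≤ 1 / ((z.2 : ℝ) + 1) := by gcongr
  obtain ⟨l, hlK, hlC⟩ := hK.inter_iInter_nonempty C hC hfin
  choose L hL hline using fun i => exists_isLine_of_equation (l := l i) fun h0 => by
    have := hlK i (Set.mem_univ i)
    rw [h0, mem_sphere_zero_iff_norm, norm_zero] at this
    exact zero_ne_one this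
  refine ⟨L, hL, fun A hA => ?_⟩
  obtain ⟨i, hi⟩ := Finite.exists_min fun i => D A (l i)
  obtain ⟨p, hp, hfp⟩ := hDmem A hA (l i)
  have hle : D A (l i) ≤ 0 := by
    refine le_of_forall_pos_lt_add fun δ hδ => ?_
    obtain ⟨N, hN⟩ := exists_nat_one_div_lt hδ
    obtain ⟨j, hj⟩ := Set.mem_iUnion.1 (Set.mem_iInter.1 hlC (⟨A, hA⟩, N))
    have hj : D A (l j) ≤ 1 / ((N : ℝ) + 1) := hj
    linarith [hi j]
  rw [← hfp] at hle
  exact ⟨p, hp, Set.mem_iUnion.2 ⟨i, hline i p (abs_nonpos_iff.1 hle)⟩⟩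

theorem theorem1 (k : ℕ) (hk : 4 ≤ k) :
    IsLeast (sufficientLineNumbers k) (leastLineNumber k) ∧
      ⌈(k : ℝ) / 2⌉₊ ≤ leastLineNumber k ∧ leastLineNumber k ≤ k - 2 := by
  have hmem : k - 2 ∈ sufficientLineNumbers k := by
    obtain ⟨n, rfl⟩ := Nat.exists_eq_add_of_le' hk
    exact mem_sufficientLineNumbers n
  have hleast : leastLineNumber k ∈ sufficientLineNumbers k := Nat.sInf_mem ⟨_, hmem⟩
  refine ⟨⟨hleast, fun n hn => Nat.sInf_le hn⟩, ?_, Nat.sInf_le hmem⟩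
  have h := two_mul_sub_one_le_of_mem_sufficientLineNumbers hk hleast
  have h' : k ≤ 2 * leastLineNumber k := by omega
  rw [Nat.ceil_le, div_le_iff₀ two_pos]
  exact_mod_cast (by omega : k ≤ leastLineNumber k * 2)
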